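/- Let $G$ be a finite simple graph that is cubic (every vertex has degree $3$) and bridgeless (no edge whose deletion separates its two endpoints). Then there exist five perfect matchings $M_1,\dots,M_5$ of $G$, not necessarily distinct, such that $$\Bigl|\,\bigcup_{i=1}^{5} E(M_i)\Bigr| \;\ge\; \Bigl\lceil \tfrac{215}{231}\,|E(G)| \Bigr\rceil ,$$ where $E(G)$ is the edge set of $G$ and $E(M_i)$ is the set of edges of $M_i$. -/

import Mathlib

/-! The matchings are chosen greedily, one at a time. Given `k` matchings, `residual` puts weight
`(k + 1 - m) / (2k + 3)` on an edge lying in `m` of them. Its degrees are 1, and an uncovered edge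
gets `(k + 1) / (2k + 3)`. If this weight lies in the perfect matching polytope, some perfect
matching in a convex decomposition covers at least that share of the uncovered edges, so at most a
fraction `(k + 2) / (2k + 3)` of them remains. Five rounds leave at most `2/3 · 3/5 · 4/7 · 5/9 ·
6/11 = 16/231` of all edges.

Membership in the polytope is an inequality on odd cuts, recorded in `IsSparse` and preserved by
`IsSparse.exists_snoc`: a matching from the decomposition meets each tight odd cut exactly once, and
parity gives room on the others.

The polytope theorem `IsFractional.isPairingSum` is proved by peeling. Tutte's theorem gives a
pairing inside the support; subtract it until an entry vanishes or a proper odd cut becomes tight.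
In the second case, decompose the contractions of the two sides and glue the decompositions along
the cut. -/

namespace PairingPolytope

universe u

/-! ### Pairings, odd cuts and fractional perfect matchings. -/

section Basic

variable {V : Type u}

/-- Fixed-point-free involutions, i.e. perfect matchings of the complete graph on `V`. -/
abbrev Pairing (V : Type u) : Type u := {f : V → V // ∀ x, f (f x) = x ∧ f x ≠ x}

namespace Pairing

lemma apply_eq_comm (f : Pairing V) {x y : V} : f.1 x = y ↔ f.1 y = x :=
  ⟨fun h => h ▸ (f.2 x).1, fun h => h ▸ (f.2 y).1⟩

/-- The characteristic function of a pairing, as a symmetric weight. -/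
def weight [DecidableEq V] (f : Pairing V) (x y : V) : ℝ := if f.1 x = y then 1 else 0

variable [DecidableEq V]

lemma weight_symm (f : Pairing V) (x y : V) : f.weight x y = f.weight y x := by
  simp only [weight, f.apply_eq_comm (x := x)]

lemma weight_self (f : Pairing V) (x : V) : f.weight x x = 0 := by
  simp [weight, (f.2 x).2]

lemma weight_nonneg (f : Pairing V) (x y : V) : 0 ≤ f.weight x y := by
  unfold weight; split_ifs <;> simp

lemma sum_weight [Fintype V] (f : Pairing V) (x : V) : ∑ y, f.weight x y = 1 := by
  simp [weight]

end Pairing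

/-- Swapping coordinates cancels the off-diagonal terms in pairs modulo 2. -/
lemma even_sum_of_symm (U : Finset V) (n : V → V → ℕ) (hs : ∀ x y, n x y = n y x)
    (hd : ∀ x, n x x = 0) : Even (∑ x ∈ U, ∑ y ∈ U, n x y) := by
  rw [← ZMod.natCast_eq_zero_iff_even, ← Finset.sum_product', Nat.cast_sum]
  refine Finset.sum_involution (fun p _ => p.swap) ?_ ?_ ?_ ?_
  · rintro ⟨x, y⟩ -
    simp only [Prod.swap]
    rw [hs y x]
    exact CharTwo.add_self_eq_zero _
  · rintro ⟨x, y⟩ - h he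
    simp only [Prod.swap, Prod.mk.injEq] at he
    rw [he.1, hd] at h
    simp at h
  · rintro ⟨x, y⟩ h
    simpa [and_comm] using h
  · rintro ⟨x, y⟩ -
    rfl

variable [Fintype V] [DecidableEq V]

/-- The total weight leaving `U`. -/
def cut (w : V → V → ℝ) (U : Finset V) : ℝ := ∑ x ∈ U, ∑ y ∈ Uᶜ, w x y

/-- Fractional perfect matchings of total degree `r`, as weights on the complete graph. -/
structure IsFractional (w : V → V → ℝ) (r : ℝ) : Prop where
  symm : ∀ x y, w x y = w y x
  diag : ∀ x, w x x = 0
  nonneg : ∀ x y, 0 ≤ w x y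
  degree : ∀ x, ∑ y, w x y = r
  le_cut : ∀ U : Finset V, Odd U.card → r ≤ cut w U

/-- Nonnegative combinations of pairings. -/
def IsPairingSum (w : V → V → ℝ) : Prop :=
  ∃ c : Pairing V → ℝ, (∀ f, 0 ≤ c f) ∧ ∀ x y, ∑ f, c f * f.weight x y = w x y

lemma IsPairingSum.of_sum {ι : Type*} [Fintype ι] {w : V → V → ℝ} (p : ι → ℝ)
    (hp : ∀ i, 0 ≤ p i) (g : ι → Pairing V) (h : ∀ x y, ∑ i, p i * (g i).weight x y = w x y) :
    IsPairingSum w := by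
  refine ⟨fun f => ∑ i, if g i = f then p i else 0,
    fun f => Finset.sum_nonneg fun i _ => by split_ifs <;> simp [hp], fun x y => ?_⟩
  rw [← h x y]
  simp_rw [Finset.sum_mul]
  rw [Finset.sum_comm]
  refine Finset.sum_congr rfl fun i _ => ?_
  simp

lemma isPairingSum_zero : IsPairingSum (fun _ _ : V => (0 : ℝ)) :=
  ⟨fun _ => 0, by simp, by simp⟩

lemma IsPairingSum.add_smul {w w' : V → V → ℝ} (h : IsPairingSum w') {ε : ℝ} (hε : 0 ≤ ε)
    (f : Pairing V) (hw : ∀ x y, w x y = w' x y + ε * f.weight x y) : IsPairingSum w := by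
  obtain ⟨c, hc, hcw⟩ := h
  refine IsPairingSum.of_sum (ι := Option (Pairing V)) (fun o => o.elim ε c)
    (by rintro (_ | g) <;> simp [hε, hc]) (fun o => o.elim f id) fun x y => ?_
  rw [Fintype.sum_option, hw, ← hcw]
  simp [add_comm]

lemma cut_eq_sum_ite (w : V → V → ℝ) (U : Finset V) :
    cut w U = ∑ x, ∑ y, if x ∈ U ∧ y ∉ U then w x y else 0 := by
  unfold cut
  rw [← Finset.sum_filter_add_sum_filter_not Finset.univ (· ∈ U)]
  rw [Finset.sum_eq_zero (s := Finset.univ.filter (¬ · ∈ U))]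
  · simp only [Finset.filter_mem_eq_inter, Finset.univ_inter, add_zero]
    refine Finset.sum_congr rfl fun x hx => ?_
    simp only [hx, true_and]
    rw [← Finset.sum_filter]
    refine Finset.sum_congr ?_ fun _ _ => rfl
    ext; simp
  · intro x hx
    simp at hx
    simp [hx]

lemma cut_compl {w : V → V → ℝ} (hw : ∀ x y, w x y = w y x) (U : Finset V) :
    cut w Uᶜ = cut w U := by
  unfold cut
  rw [compl_compl, Finset.sum_comm]
  exact Finset.sum_congr rfl fun _ _ => Finset.sum_congr rfl fun _ _ => hw _ _

lemma cut_singleton {w : V → V → ℝ} (hw : ∀ x, w x x = 0) (x : V) :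
    cut w {x} = ∑ y, w x y := by
  rw [cut, Finset.sum_singleton, ← Finset.sum_add_sum_compl {x}]
  simp [hw]

lemma cut_sub_smul (w v : V → V → ℝ) (ε : ℝ) (U : Finset V) :
    cut (fun x y => w x y - ε * v x y) U = cut w U - ε * cut v U := by
  simp [cut, Finset.sum_sub_distrib, Finset.mul_sum]

/-- Handshaking: if all degrees are odd, odd sets have odd cuts. -/
lemma odd_natCut (n : V → V → ℕ) (hs : ∀ x y, n x y = n y x) (hd : ∀ x, n x x = 0)
    (hdeg : ∀ x, Odd (∑ y, n x y)) {U : Finset V} (hU : Odd U.card) :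
    Odd (∑ x ∈ U, ∑ y ∈ Uᶜ, n x y) := by
  have h1 : Odd (∑ x ∈ U, ∑ y, n x y) := by
    rw [Finset.odd_sum_iff_odd_card_odd, Finset.filter_true_of_mem fun x _ => hdeg x]
    exact hU
  have h2 := even_sum_of_symm U n hs hd
  simp_rw [← Finset.sum_add_sum_compl U, Finset.sum_add_distrib] at h1
  by_contra h3
  rw [Nat.not_odd_iff_even] at h3
  exact Nat.not_even_iff_odd.2 h1 (h2.add h3)

/-- The number of pairs of `f` leaving `U`. -/
def Pairing.crossing (f : Pairing V) (U : Finset V) : ℕ :=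
  ∑ x ∈ U, ∑ y ∈ Uᶜ, if f.1 x = y then 1 else 0

lemma Pairing.cut_weight (f : Pairing V) (U : Finset V) : cut f.weight U = f.crossing U := by
  simp only [cut, Pairing.weight, Pairing.crossing, Nat.cast_sum, Nat.cast_ite, Nat.cast_one,
    Nat.cast_zero]

lemma Pairing.odd_crossing (f : Pairing V) {U : Finset V} (hU : Odd U.card) :
    Odd (f.crossing U) := by
  refine odd_natCut (fun x y => if f.1 x = y then 1 else 0) (fun x y => ?_) (fun x => ?_)
    (fun x => ?_) hU
  · simp only [f.apply_eq_comm (x := x)]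
  · simp [(f.2 x).2]
  · simp

lemma Pairing.one_le_cut (f : Pairing V) {U : Finset V} (hU : Odd U.card) :
    1 ≤ cut f.weight U := by
  rw [f.cut_weight]
  exact_mod_cast (f.odd_crossing hU).pos

end Basic

/-! ### Coupling of weighted families. -/

/-- Two families of weights with compatible marginals along `t₁` and `t₂` admit a coupling. -/
lemma exists_coupling {F₁ F₂ A₁ A₂ : Type*} [Fintype F₁] [Fintype F₂] [Fintype A₁] [Fintype A₂]
    [DecidableEq A₁] [DecidableEq A₂] (t₁ : F₁ → A₁) (t₂ : F₂ → A₂) (c₁ : F₁ → ℝ) (c₂ : F₂ → ℝ)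
    (m : A₁ → A₂ → ℝ) (h₁ : ∀ f, 0 ≤ c₁ f) (h₂ : ∀ f, 0 ≤ c₂ f) (hm : ∀ a b, 0 ≤ m a b)
    (hc₁ : ∀ a, ∑ f, (if t₁ f = a then c₁ f else 0) = ∑ b, m a b)
    (hc₂ : ∀ b, ∑ f, (if t₂ f = b then c₂ f else 0) = ∑ a, m a b) :
    ∃ P : F₁ → F₂ → ℝ, (∀ f g, 0 ≤ P f g) ∧ (∀ f, ∑ g, P f g = c₁ f) ∧
      (∀ g, ∑ f, P f g = c₂ g) ∧
      ∀ a b, ∑ f, ∑ g, (if t₁ f = a ∧ t₂ g = b then P f g else 0) = m a b := by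
  set d₁ : A₁ → ℝ := fun a => ∑ b, m a b with hd₁
  set d₂ : A₂ → ℝ := fun b => ∑ a, m a b with hd₂
  have hd₁0 : ∀ a, 0 ≤ d₁ a := fun a => Finset.sum_nonneg fun b _ => hm a b
  have hd₂0 : ∀ b, 0 ≤ d₂ b := fun b => Finset.sum_nonneg fun a _ => hm a b
  have hz₁ : ∀ a b, d₁ a = 0 → m a b = 0 := fun a b h =>
    (Finset.sum_eq_zero_iff_of_nonneg fun b _ => hm a b).1 h b (Finset.mem_univ _)
  have hz₂ : ∀ a b, d₂ b = 0 → m a b = 0 := fun a b h =>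
    (Finset.sum_eq_zero_iff_of_nonneg fun a _ => hm a b).1 h a (Finset.mem_univ _)
  have hcz₁ : ∀ f, d₁ (t₁ f) = 0 → c₁ f = 0 := fun f h => by
    have := (Finset.sum_eq_zero_iff_of_nonneg
      (fun g _ => by split_ifs <;> simp [h₁])).1 ((hc₁ (t₁ f)).trans h) f (Finset.mem_univ _)
    simpa using this
  have hcz₂ : ∀ f, d₂ (t₂ f) = 0 → c₂ f = 0 := fun f h => by
    have := (Finset.sum_eq_zero_iff_of_nonneg
      (fun g _ => by split_ifs <;> simp [h₂])).1 ((hc₂ (t₂ f)).trans h) f (Finset.mem_univ _)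
    simpa using this
  have fib₁ : ∀ q : A₁ → ℝ, ∑ f, q (t₁ f) * c₁ f = ∑ a, q a * d₁ a := fun q => by
    simp_rw [hd₁, ← hc₁, Finset.mul_sum]
    rw [Finset.sum_comm]
    simp
  have fib₂ : ∀ q : A₂ → ℝ, ∑ f, q (t₂ f) * c₂ f = ∑ a, q a * d₂ a := fun q => by
    simp_rw [hd₂, ← hc₂, Finset.mul_sum]
    rw [Finset.sum_comm]
    simp
  -- Draw the two types from `m`, then `f` and `g` independently given their types. Division by zero
  -- giving 0 is harmless: a vanishing marginal forces the corresponding `m` and `c₁` or `c₂` to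
  -- vanish.
  refine ⟨fun f g => m (t₁ f) (t₂ g) / d₁ (t₁ f) / d₂ (t₂ g) * c₁ f * c₂ g, fun f g => ?_,
    fun f => ?_, fun g => ?_, fun a b => ?_⟩
  · have := hm (t₁ f) (t₂ g)
    have := hd₁0 (t₁ f)
    have := hd₂0 (t₂ g)
    have := h₁ f
    have := h₂ g
    positivity
  · rw [fib₂ fun b => m (t₁ f) b / d₁ (t₁ f) / d₂ b * c₁ f]
    have : ∀ b, m (t₁ f) b / d₁ (t₁ f) / d₂ b * c₁ f * d₂ b = m (t₁ f) b * (c₁ f / d₁ (t₁ f)) := by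
      intro b
      by_cases h : d₂ b = 0
      · simp [h, hz₂ _ _ h]
      · field_simp
    simp_rw [this, ← Finset.sum_mul]
    change d₁ (t₁ f) * _ = _
    by_cases h : d₁ (t₁ f) = 0
    · simp [h, hcz₁ f h]
    · field_simp
  · have : ∀ f, m (t₁ f) (t₂ g) / d₁ (t₁ f) / d₂ (t₂ g) * c₁ f * c₂ g =
        m (t₁ f) (t₂ g) / d₁ (t₁ f) / d₂ (t₂ g) * c₂ g * c₁ f := fun f => by ring
    simp_rw [this]
    rw [fib₁ fun a => m a (t₂ g) / d₁ a / d₂ (t₂ g) * c₂ g]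
    have : ∀ a, m a (t₂ g) / d₁ a / d₂ (t₂ g) * c₂ g * d₁ a = m a (t₂ g) * (c₂ g / d₂ (t₂ g)) := by
      intro a
      by_cases h : d₁ a = 0
      · simp [h, hz₁ _ _ h]
      · field_simp
    simp_rw [this, ← Finset.sum_mul]
    change d₂ (t₂ g) * _ = _
    by_cases h : d₂ (t₂ g) = 0
    · simp [h, hcz₂ g h]
    · field_simp
  · have : ∀ f g, (if t₁ f = a ∧ t₂ g = b then
        m (t₁ f) (t₂ g) / d₁ (t₁ f) / d₂ (t₂ g) * c₁ f * c₂ g else 0) =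
        m a b / d₁ a / d₂ b * ((if t₁ f = a then c₁ f else 0) * (if t₂ g = b then c₂ g else 0)) := by
      intro f g
      by_cases h : t₁ f = a <;> by_cases h' : t₂ g = b <;> simp [h, h', mul_assoc]
    simp_rw [this, ← Finset.mul_sum, hc₂, ← Finset.sum_mul, hc₁]
    change m a b / d₁ a / d₂ b * (d₁ a * d₂ b) = m a b
    by_cases h : d₁ a = 0
    · simp [h, hz₁ _ _ h]
    by_cases h' : d₂ b = 0
    · simp [h', hz₂ _ _ h']
    field_simp

/-! ### Contracting one side of a cut, and gluing pairings. -/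

section Contraction

variable {V : Type u} [DecidableEq V]

/-- The map collapsing the complement of `S` to one point. -/
def proj (S : Finset V) (x : V) : Option S := if h : x ∈ S then some ⟨x, h⟩ else none

lemma proj_eq_some {S : Finset V} {x : V} {a : S} : proj S x = some a ↔ x = a := by
  unfold proj
  split_ifs with h
  · simp [Subtype.ext_iff]
  · simp only [false_iff]
    rintro rfl
    exact h a.2

lemma proj_eq_none {S : Finset V} {x : V} : proj S x = none ↔ x ∉ S := by
  unfold proj
  split_ifs with h <;> simp [h]

variable [Fintype V]

/-- The weight obtained from `w` by collapsing the complement of `S` to one point. -/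
def contract (S : Finset V) (w : V → V → ℝ) (a b : Option S) : ℝ :=
  if a = b then 0 else ∑ x, ∑ y, if proj S x = a ∧ proj S y = b then w x y else 0

lemma contract_some_some {S : Finset V} {w : V → V → ℝ} (hd : ∀ x, w x x = 0) (a b : S) :
    contract S w (some a) (some b) = w a b := by
  unfold contract
  split_ifs with h
  · cases h; rw [hd]
  · simp [proj_eq_some, ite_and]

lemma contract_none_some {S : Finset V} {w : V → V → ℝ} (b : S) :
    contract S w none (some b) = ∑ x ∈ Sᶜ, w x b := by
  unfold contract
  rw [if_neg (by simp)]
  simp only [proj_eq_none, proj_eq_some, ite_and, Finset.sum_ite_irrel, Finset.sum_ite_eq',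
    Finset.mem_univ, if_true, Finset.sum_const_zero]
  rw [← Finset.sum_filter]
  refine Finset.sum_congr ?_ fun _ _ => rfl
  ext; simp

/-- Cuts of the contraction are cuts of the original weight. Through singletons this also gives the
degrees, so it transfers both conditions of `IsFractional`. -/
lemma cut_contract (S : Finset V) (w : V → V → ℝ) (T : Finset (Option S)) :
    cut (contract S w) T = cut w (Finset.univ.filter (proj S · ∈ T)) := by
  rw [cut_eq_sum_ite, cut_eq_sum_ite]
  have h : ∀ a b, (if a ∈ T ∧ b ∉ T then contract S w a b else 0) =
      ∑ x, ∑ y, if proj S x = a then (if proj S y = b then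
        (if a ∈ T ∧ b ∉ T then w x y else 0) else 0) else 0 := by
    intro a b
    by_cases hab : a ∈ T ∧ b ∉ T
    · have hne : a ≠ b := by rintro rfl; exact hab.2 hab.1
      simp [hab, contract, hne, ite_and]
    · simp [hab]
  simp_rw [h]
  calc _ = ∑ a, ∑ x, ∑ b, ∑ y, (if proj S x = a then (if proj S y = b then
        (if a ∈ T ∧ b ∉ T then w x y else 0) else 0) else 0) :=
        Finset.sum_congr rfl fun a _ => Finset.sum_comm
    _ = ∑ x, ∑ a, ∑ y, ∑ b, (if proj S x = a then (if proj S y = b then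
        (if a ∈ T ∧ b ∉ T then w x y else 0) else 0) else 0) := by
        rw [Finset.sum_comm]
        exact Finset.sum_congr rfl fun x _ => Finset.sum_congr rfl fun a _ => Finset.sum_comm
    _ = ∑ x, ∑ y, ∑ a, ∑ b, (if proj S x = a then (if proj S y = b then
        (if a ∈ T ∧ b ∉ T then w x y else 0) else 0) else 0) :=
        Finset.sum_congr rfl fun a _ => Finset.sum_comm
    _ = _ := by
        refine Finset.sum_congr rfl fun x _ => Finset.sum_congr rfl fun y _ => ?_
        simp only [Finset.sum_ite_irrel, Finset.sum_const_zero, Finset.sum_ite_eq,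
          Finset.mem_univ, if_true, Finset.mem_filter, true_and]

lemma filter_proj_some {S : Finset V} (a : S) :
    Finset.univ.filter (proj S · = some a) = {(a : V)} := by
  ext; simp [proj_eq_some]

lemma filter_proj_none {S : Finset V} : Finset.univ.filter (proj S · = none) = Sᶜ := by
  ext; simp [proj_eq_none]

/-- Every fibre of `proj S` is a singleton or `Sᶜ`, hence odd, so pulling back preserves parity. -/
lemma odd_card_filter_proj {S : Finset V} (hS : Odd Sᶜ.card) {T : Finset (Option S)}
    (hT : Odd T.card) : Odd (Finset.univ.filter (proj S · ∈ T)).card := by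
  rw [Finset.card_eq_sum_card_fiberwise (f := proj S) (t := T) fun x hx => by simpa using hx,
    Finset.odd_sum_iff_odd_card_odd, Finset.filter_true_of_mem]
  · exact hT
  · intro a ha
    have : (Finset.univ.filter (proj S · ∈ T)).filter (proj S · = a) =
        Finset.univ.filter (proj S · = a) := by
      ext x
      simp only [Finset.mem_filter, Finset.mem_univ, true_and, and_iff_right_iff_imp]
      rintro rfl
      exact ha
    rw [this]
    rcases a with _ | a
    · rwa [filter_proj_none]
    · simp [filter_proj_some]

lemma contract_self {S : Finset V} {w : V → V → ℝ} (a : Option S) : contract S w a a = 0 := by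
  simp [contract]

/-- Tightness of the cut is exactly what gives the new point degree `r`. -/
lemma IsFractional.contract {w : V → V → ℝ} {r : ℝ} (hw : IsFractional w r) {S : Finset V}
    (hS : Odd Sᶜ.card) (hcut : cut w S = r) : IsFractional (contract S w) r where
  symm a b := by
    unfold PairingPolytope.contract
    simp only [eq_comm (a := a) (b := b)]
    rw [Finset.sum_comm]
    congr 1
    refine Finset.sum_congr rfl fun x _ => Finset.sum_congr rfl fun y _ => ?_
    rw [hw.symm x y]
    simp only [and_comm]
  diag a := contract_self a
  nonneg a b := by
    unfold PairingPolytope.contract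
    split_ifs
    · exact le_rfl
    · refine Finset.sum_nonneg fun x _ => Finset.sum_nonneg fun y _ => ?_
      split_ifs
      · exact hw.nonneg x y
      · exact le_rfl
  degree a := by
    rw [← cut_singleton (fun a => contract_self a) a, cut_contract]
    simp only [Finset.mem_singleton]
    rcases a with _ | a
    · rw [filter_proj_none, cut_compl hw.symm, hcut]
    · rw [filter_proj_some, cut_singleton hw.diag, hw.degree]
  le_cut T hT := by
    rw [cut_contract]
    exact hw.le_cut _ (odd_card_filter_proj hS hT)

namespace Pairing

variable {α : Type*}

lemma isSome_none (f : Pairing (Option α)) : (f.1 none).isSome :=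
  Option.isSome_iff_ne_none.2 (f.2 none).2

/-- The partner of the extra point. -/
def apex (f : Pairing (Option α)) : α := (f.1 none).get f.isSome_none

lemma apply_none (f : Pairing (Option α)) : f.1 none = some f.apex := by simp [apex]

lemma apex_eq_iff (f : Pairing (Option α)) {a : α} : f.apex = a ↔ f.1 none = some a := by
  rw [apply_none, Option.some_inj]

lemma apply_some_eq_none (f : Pairing (Option α)) {a : α} : f.1 (some a) = none ↔ f.apex = a := by
  rw [apex_eq_iff, apply_eq_comm]

/-- The union of pairings of the two contractions of `V` along the cut `U`, with the pair between
the two partners of the contracted points. -/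
def glueFun {U : Finset V} (f : Pairing (Option U)) (g : Pairing (Option ↥Uᶜ)) (x : V) : V :=
  if h : x ∈ U then (f.1 (some ⟨x, h⟩)).elim (g.apex : V) fun y => (y : V)
  else (g.1 (some ⟨x, Finset.mem_compl.2 h⟩)).elim (f.apex : V) fun y => (y : V)

variable {U : Finset V} (f : Pairing (Option U)) (g : Pairing (Option ↥Uᶜ))

lemma glueFun_left_left (a b : U) : glueFun f g a = b ↔ f.1 (some a) = some b := by
  unfold glueFun
  rw [dif_pos a.2]
  rcases h : f.1 (some a) with _ | c
  · simp only [Option.elim_none, reduceCtorEq, iff_false]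
    exact fun h' => Finset.mem_compl.1 g.apex.2 (h' ▸ b.2)
  · rw [Option.some_inj, Subtype.ext_iff, Option.elim_some]

lemma glueFun_left_right (a : U) (b : ↥Uᶜ) :
    glueFun f g a = b ↔ f.apex = a ∧ g.apex = b := by
  unfold glueFun
  rw [dif_pos a.2, ← apply_some_eq_none]
  rcases h : f.1 (some a) with _ | c
  · rw [Option.elim_none, Subtype.ext_iff, and_iff_right rfl]
  · simp only [Option.elim_some, reduceCtorEq, false_and, iff_false]
    exact fun h' => Finset.mem_compl.1 b.2 (h' ▸ c.2)

lemma glueFun_right_right (a b : ↥Uᶜ) : glueFun f g a = b ↔ g.1 (some a) = some b := by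
  unfold glueFun
  rw [dif_neg (Finset.mem_compl.1 a.2)]
  rcases h : g.1 (some a) with _ | c
  · simp only [Option.elim_none, reduceCtorEq, iff_false]
    exact fun h' => Finset.mem_compl.1 b.2 (h' ▸ f.apex.2)
  · rw [Option.some_inj, Subtype.ext_iff, Option.elim_some]

lemma glueFun_right_left (a : ↥Uᶜ) (b : U) :
    glueFun f g a = b ↔ f.apex = b ∧ g.apex = a := by
  unfold glueFun
  rw [dif_neg (Finset.mem_compl.1 a.2), ← g.apply_some_eq_none]
  rcases h : g.1 (some a) with _ | c
  · rw [Option.elim_none, Subtype.ext_iff, and_iff_left rfl]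
  · simp only [Option.elim_some, reduceCtorEq, and_false, iff_false]
    exact fun h' => Finset.mem_compl.1 c.2 (h' ▸ b.2)

lemma glueFun_symm {x y : V} (h : glueFun f g x = y) : glueFun f g y = x := by
  by_cases hx : x ∈ U <;> by_cases hy : y ∈ U
  · lift x to U using hx
    lift y to U using hy
    rw [glueFun_left_left] at h ⊢
    exact f.apply_eq_comm.1 h
  · lift x to U using hx
    lift y to ↥Uᶜ using Finset.mem_compl.2 hy
    rw [glueFun_left_right] at h
    rwa [glueFun_right_left]
  · lift x to ↥Uᶜ using Finset.mem_compl.2 hx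
    lift y to U using hy
    rw [glueFun_right_left] at h
    rwa [glueFun_left_right]
  · lift x to ↥Uᶜ using Finset.mem_compl.2 hx
    lift y to ↥Uᶜ using Finset.mem_compl.2 hy
    rw [glueFun_right_right] at h ⊢
    exact g.apply_eq_comm.1 h

/-- Gluing as a pairing. -/
def glue : Pairing V := ⟨glueFun f g, fun x => ⟨glueFun_symm f g rfl, by
  by_cases hx : x ∈ U
  · lift x to U using hx
    rw [Ne, glueFun_left_left]
    exact (f.2 _).2
  · lift x to ↥Uᶜ using Finset.mem_compl.2 hx
    rw [Ne, glueFun_right_right]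
    exact (g.2 _).2⟩⟩

end Pairing

/-- In either contraction, the pairings matching the extra point with `a` have total coefficient
equal to the weight from `a` across the cut. Both are marginals of `w` restricted to the cut, so a
coupling with that joint law of apexes glues the decompositions and recovers `w` on crossing pairs.
-/
lemma isPairingSum_of_contract {w : V → V → ℝ} (hs : ∀ x y, w x y = w y x)
    (hd : ∀ x, w x x = 0) (hw : ∀ x y, 0 ≤ w x y) (U : Finset V)
    (h₁ : IsPairingSum (contract U w)) (h₂ : IsPairingSum (contract Uᶜ w)) : IsPairingSum w := by
  obtain ⟨c₁, hc₁, hcw₁⟩ := h₁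
  obtain ⟨c₂, hc₂, hcw₂⟩ := h₂
  obtain ⟨P, hP, hP₁, hP₂, hPm⟩ := exists_coupling (fun f : Pairing (Option U) => f.apex)
    (fun g : Pairing (Option ↥Uᶜ) => g.apex) c₁ c₂ (fun a b => w a b) hc₁ hc₂
    (fun a b => hw _ _) (fun a => by
      have := hcw₁ none (some a)
      rw [contract_none_some, ← Finset.sum_coe_sort Uᶜ (fun x => w x a)] at this
      simp only [hs _ (a : V)] at this
      rw [← this]
      refine Finset.sum_congr rfl fun f _ => ?_
      simp [Pairing.weight, f.apex_eq_iff])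
    (fun b => by
      have := hcw₂ none (some b)
      rw [contract_none_some, compl_compl, ← Finset.sum_coe_sort U (fun x => w x b)] at this
      rw [← this]
      refine Finset.sum_congr rfl fun f _ => ?_
      simp [Pairing.weight, f.apex_eq_iff])
  have key : ∀ (a : U) (b : ↥Uᶜ), ∑ i : Pairing (Option U) × Pairing (Option ↥Uᶜ),
      P i.1 i.2 * (i.1.glue i.2).weight a b = w a b := by
    intro a b
    rw [Fintype.sum_prod_type, ← hPm]
    simp [Pairing.weight, Pairing.glue, Pairing.glueFun_left_right]
  refine IsPairingSum.of_sum (fun i : Pairing (Option U) × Pairing (Option ↥Uᶜ) => P i.1 i.2)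
    (fun i => hP _ _) (fun i => i.1.glue i.2) fun x y => ?_
  by_cases hx : x ∈ U <;> by_cases hy : y ∈ U
  · lift x to U using hx
    lift y to U using hy
    rw [← contract_some_some hd x y, ← hcw₁, Fintype.sum_prod_type]
    simp only [Pairing.weight, Pairing.glue, Pairing.glueFun_left_left, ← Finset.sum_mul, hP₁]
  · lift x to U using hx
    lift y to ↥Uᶜ using Finset.mem_compl.2 hy
    exact key x y
  · lift x to ↥Uᶜ using Finset.mem_compl.2 hx
    lift y to U using hy
    simp_rw [Pairing.weight_symm _ (x : V) y, hs (x : V) y]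
    exact key y x
  · lift x to ↥Uᶜ using Finset.mem_compl.2 hx
    lift y to ↥Uᶜ using Finset.mem_compl.2 hy
    rw [← contract_some_some hd x y, ← hcw₂, Fintype.sum_prod_type, Finset.sum_comm]
    simp only [Pairing.weight, Pairing.glue, Pairing.glueFun_right_right, ← Finset.sum_mul, hP₂]

end Contraction

/-! ### Edmonds' theorem by peeling off pairings. -/

section Peeling

variable {V : Type u} [Fintype V] [DecidableEq V]

open SimpleGraph in
/-- By Tutte's theorem, the support of a fractional perfect matching contains a perfect matching. -/
lemma IsFractional.exists_pairing_support {w : V → V → ℝ} {r : ℝ} (hw : IsFractional w r)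
    (hr : 0 < r) : ∃ f : Pairing V, ∀ x, 0 < w x (f.1 x) := by
  classical
  let G : SimpleGraph V :=
    { Adj := fun x y => 0 < w x y
      symm := ⟨fun x y h => by rwa [hw.symm y x]⟩
      loopless := ⟨fun x h => by simp [hw.diag] at h⟩ }
  suffices h : ∃ M : G.Subgraph, M.IsPerfectMatching by
    obtain ⟨M, hM⟩ := h
    rw [Subgraph.isPerfectMatching_iff] at hM
    choose f hf hf' using hM
    refine ⟨⟨f, fun x => ⟨(hf' _ _ (hf x).symm).symm, fun h => ?_⟩⟩, fun x => (hf x).adj_sub⟩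
    have := hf x
    rw [h] at this
    exact this.ne rfl
  rw [tutte]
  intro u hu
  unfold IsTutteViolator at hu
  set H := ((⊤ : G.Subgraph).deleteVerts u).coe with hH
  let K : H.ConnectedComponent → Finset V := fun c => (Subtype.val '' c.supp).toFinset
  have hK : ∀ c x, x ∈ K c ↔ ∃ h, H.connectedComponentMk ⟨x, h⟩ = c := by
    intro c x
    simp [K]
  have hKu : ∀ c x, x ∈ K c → x ∉ u := by
    intro c x hx
    obtain ⟨h, -⟩ := (hK c x).1 hx
    simpa using h
  have hodd : ∀ c ∈ H.oddComponents, Odd (K c).card := by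
    intro c hc
    rw [← Set.ncard_eq_toFinset_card', Set.ncard_image_of_injective _ Subtype.val_injective]
    exact hc
  -- Weight leaving a component can only go to `u`. Each odd component sends at least `r` there,
  -- while `u` receives at most `r` per vertex, so no Tutte violator exists.
  have hcut : ∀ c ∈ H.oddComponents, r ≤ ∑ x ∈ K c, ∑ y ∈ u.toFinset, w x y := by
    intro c hc
    refine (hw.le_cut _ (hodd c hc)).trans (Finset.sum_le_sum fun x hx => ?_)
    rw [← Finset.sum_filter_of_ne (p := (· ∈ u)) ?_]
    · exact Finset.sum_le_sum_of_subset_of_nonneg (fun y hy => by simp_all)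
        fun y _ _ => hw.nonneg x y
    intro y hy hne
    have hadj : G.Adj x y := lt_of_le_of_ne (hw.nonneg x y) (Ne.symm hne)
    by_contra hyu
    refine Finset.mem_compl.1 hy ((hK c y).2 ⟨by simpa using hyu, ?_⟩)
    obtain ⟨h, rfl⟩ := (hK c x).1 hx
    refine ConnectedComponent.sound (Adj.reachable ?_)
    have hxu := hKu _ x hx
    simp [hH, hyu, hxu, hadj.symm]
  have hdisj : Set.PairwiseDisjoint (H.oddComponents.toFinset : Set H.ConnectedComponent) K := by
    intro c _ d _ hcd
    refine Finset.disjoint_left.2 fun x hx hx' => hcd ?_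
    obtain ⟨_, h⟩ := (hK c x).1 hx
    obtain ⟨_, h'⟩ := (hK d x).1 hx'
    exact h.symm.trans h'
  have h1 : (H.oddComponents.ncard : ℝ) * r ≤
      ∑ c ∈ H.oddComponents.toFinset, ∑ x ∈ K c, ∑ y ∈ u.toFinset, w x y := by
    rw [Set.ncard_eq_toFinset_card', ← nsmul_eq_mul]
    exact Finset.card_nsmul_le_sum _ _ _ fun c hc => hcut c (by simpa using hc)
  rw [← Finset.sum_biUnion hdisj] at h1
  have h2 : ∑ x ∈ H.oddComponents.toFinset.biUnion K, ∑ y ∈ u.toFinset, w x y ≤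
      ∑ x, ∑ y ∈ u.toFinset, w x y :=
    Finset.sum_le_sum_of_subset_of_nonneg (Finset.subset_univ _) fun x _ _ =>
      Finset.sum_nonneg fun y _ => hw.nonneg x y
  have h3 : ∑ x, ∑ y ∈ u.toFinset, w x y = u.ncard * r := by
    rw [Finset.sum_comm, Set.ncard_eq_toFinset_card', ← nsmul_eq_mul]
    refine Finset.sum_eq_card_nsmul fun y _ => ?_
    simp_rw [hw.symm _ y]
    exact hw.degree y
  have h4 : (u.ncard : ℝ) < H.oddComponents.ncard := by exact_mod_cast hu
  nlinarith

/-- Ratio test: the largest step keeping finitely many affine functions nonnegative. -/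
lemma exists_max_step {ι : Type*} [Fintype ι] (a b : ι → ℝ) (ha : ∀ i, 0 ≤ a i)
    (hb : ∀ i, 0 ≤ b i) (hex : ∃ i, 0 < b i) :
    ∃ ε, 0 ≤ ε ∧ (∀ i, ε * b i ≤ a i) ∧ ∃ i, 0 < b i ∧ ε * b i = a i := by
  classical
  obtain ⟨j, hj⟩ := hex
  obtain ⟨i, hi, hmin⟩ := Finset.exists_min_image (Finset.univ.filter (0 < b ·))
    (fun i => a i / b i) ⟨j, by simpa using hj⟩
  simp only [Finset.mem_filter, Finset.mem_univ, true_and] at hi hmin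
  refine ⟨a i / b i, div_nonneg (ha i) (hb i), fun k => ?_, i, hi, by field_simp⟩
  rcases (hb k).eq_or_lt with hk | hk
  · rw [← hk, mul_zero]
    exact ha k
  · exact (le_div_iff₀ hk).1 (hmin k hk)

/-- Both sides of the cut are odd and have more than one element. -/
def IsProperOdd (U : Finset V) : Prop :=
  Odd U.card ∧ Odd Uᶜ.card ∧ 1 < U.card ∧ 1 < Uᶜ.card

/-- A pairing forces `V` to have even order, so `Uᶜ` is odd too; if either side is a single vertex,
the cut is a degree. Only proper odd cuts can therefore obstruct peeling. -/
lemma IsFractional.cut_eq_or_isProperOdd {w : V → V → ℝ} {r : ℝ} (hs : ∀ x y, w x y = w y x)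
    (hd : ∀ x, w x x = 0) (hdeg : ∀ x, ∑ y, w x y = r) (f : Pairing V)
    {U : Finset V} (hU : Odd U.card) : cut w U = r ∨ IsProperOdd U := by
  have hsing : ∀ T : Finset V, T.card = 1 → cut w T = r := by
    intro T hT
    obtain ⟨x, rfl⟩ := Finset.card_eq_one.1 hT
    rw [cut_singleton hd, hdeg]
  have hUc : Odd Uᶜ.card := by
    have hV : Even (Fintype.card V) := by
      by_contra h
      have := f.odd_crossing (U := Finset.univ) (by simpa using h)
      simp [Pairing.crossing] at this
    rw [← U.card_add_card_compl] at hV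
    exact (Nat.even_add'.1 hV).1 hU
  rcases Nat.eq_or_lt_of_le hU.pos with h | h
  · exact Or.inl (hsing U h.symm)
  rcases Nat.eq_or_lt_of_le hUc.pos with h' | h'
  · rw [← cut_compl hs]
    exact Or.inl (hsing _ h'.symm)
  exact Or.inr ⟨hU, hUc, h, h'⟩

lemma IsFractional.eq_zero_or_pos {w : V → V → ℝ} {r : ℝ} (hw : IsFractional w r) :
    w = (fun _ _ => 0) ∨ 0 < r := by
  rcases lt_or_ge 0 r with h | h
  · exact Or.inr h
  refine Or.inl (funext₂ fun x y => ?_)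
  have := Finset.single_le_sum (fun y _ => hw.nonneg x y) (Finset.mem_univ y)
  rw [hw.degree] at this
  exact le_antisymm (this.trans h) (hw.nonneg x y)

/-- Subtracting a multiple of a pairing as far as possible. -/
lemma IsFractional.exists_sub {w : V → V → ℝ} {r : ℝ} (hw : IsFractional w r) (hr : 0 < r)
    [Nonempty V] : ∃ (f : Pairing V) (ε : ℝ), 0 ≤ ε ∧ (∀ x, 0 < w x (f.1 x)) ∧
      IsFractional (fun x y => w x y - ε * f.weight x y) (r - ε) ∧
      ((∃ x, w x (f.1 x) = ε) ∨ ∃ U, IsProperOdd U ∧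
        cut (fun x y => w x y - ε * f.weight x y) U = r - ε) := by
  classical
  obtain ⟨f, hf⟩ := hw.exists_pairing_support hr
  -- The constraints are the entries on pairs of `f`, which drop at rate 1, and the slacks `cut w U
  -- - r`, which drop at rate `cut f.weight U - 1` because `r` drops as well.
  obtain ⟨ε, hε, hle, i, hi, hie⟩ := exists_max_step (ι := V ⊕ {U : Finset V // IsProperOdd U})
    (Sum.elim (fun x => w x (f.1 x)) (fun U => cut w U - r))
    (Sum.elim (fun _ => 1) (fun U => cut f.weight U - 1))
    (by
      rintro (x | U)
      · exact (hf x).le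
      · exact sub_nonneg.2 (hw.le_cut _ U.2.1))
    (by
      rintro (x | U)
      · exact zero_le_one
      · exact sub_nonneg.2 (f.one_le_cut U.2.1))
    ⟨Sum.inl (Classical.arbitrary V), zero_lt_one⟩
  have hs : ∀ x y, w x y - ε * f.weight x y = w y x - ε * f.weight y x := fun x y => by
    rw [hw.symm, f.weight_symm]
  have hd : ∀ x, w x x - ε * f.weight x x = 0 := fun x => by simp [hw.diag, f.weight_self]
  have hdeg : ∀ x, ∑ y, (w x y - ε * f.weight x y) = r - ε := fun x => by
    rw [Finset.sum_sub_distrib, ← Finset.mul_sum, hw.degree, f.sum_weight, mul_one]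
  refine ⟨f, ε, hε, hf, ⟨hs, hd, fun x y => ?_, hdeg, fun U hU => ?_⟩, ?_⟩
  · by_cases h : f.1 x = y
    · have := hle (Sum.inl x)
      simp only [Sum.elim_inl, mul_one] at this
      rw [Pairing.weight, if_pos h, mul_one, ← h]
      linarith
    · simpa [Pairing.weight, h] using hw.nonneg x y
  · rcases IsFractional.cut_eq_or_isProperOdd hs hd hdeg f hU with h | h
    · exact h.ge
    · have := hle (Sum.inr ⟨U, h⟩)
      simp only [Sum.elim_inr] at this
      rw [cut_sub_smul]
      linarith
  · rcases i with x | U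
    · exact Or.inl ⟨x, by simpa using hie.symm⟩
    · refine Or.inr ⟨U, U.2, ?_⟩
      simp only [Sum.elim_inr] at hie
      rw [cut_sub_smul]
      linarith

end Peeling

/-- Induction step along a tight proper odd cut. -/
lemma IsFractional.isPairingSum_of_tight {V : Type u} [Fintype V] [DecidableEq V]
    {w : V → V → ℝ} {r : ℝ} (hw : IsFractional w r) {U : Finset V} (hU : IsProperOdd U)
    (hcut : cut w U = r)
    (ih : ∀ (W : Type u) [Fintype W] [DecidableEq W], Fintype.card W < Fintype.card V →
      ∀ w' : W → W → ℝ, IsFractional w' r → IsPairingSum w') : IsPairingSum w := by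
  obtain ⟨ho, hoc, h1, h1c⟩ := hU
  have hV := U.card_add_card_compl
  refine isPairingSum_of_contract hw.symm hw.diag hw.nonneg U (ih _ ?_ _ (hw.contract hoc hcut))
    (ih _ ?_ _ (hw.contract (by rwa [compl_compl]) (by rwa [cut_compl hw.symm])))
  · have : Uᶜ.card ≠ 2 := by rintro h; rw [h] at hoc; exact absurd hoc (by decide)
    simp only [Fintype.card_option, Fintype.card_coe]
    omega
  · have : U.card ≠ 2 := by rintro h; rw [h] at ho; exact absurd ho (by decide)
    simp only [Fintype.card_option, Fintype.card_coe]
    omega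

/-- **Edmonds' perfect matching polytope theorem.** -/
theorem IsFractional.isPairingSum {V : Type u} [Fintype V] [DecidableEq V] {w : V → V → ℝ} {r : ℝ}
    (hw : IsFractional w r) : IsPairingSum w := by
  induction hn : Fintype.card V using Nat.strong_induction_on generalizing V r with
  | _ n ihn =>
  have ih : ∀ (r : ℝ) (W : Type u) [Fintype W] [DecidableEq W],
      Fintype.card W < Fintype.card V →
      ∀ w' : W → W → ℝ, IsFractional w' r → IsPairingSum w' :=
    fun r W _ _ hW w' hw' => ihn _ (hn ▸ hW) hw' rfl
  -- Inner induction on the support: peeling either kills an entry, keeping `V`, or makes a cut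
  -- tight, which reduces to smaller vertex sets.
  induction hm : (Finset.univ.filter fun p : V × V => w p.1 p.2 ≠ 0).card
    using Nat.strong_induction_on generalizing w r with
  | _ m ihm =>
  rcases hw.eq_zero_or_pos with rfl | hr
  · exact isPairingSum_zero
  rcases isEmpty_or_nonempty V with hV | hV
  · exact ⟨fun _ => 0, by simp, fun x => hV.elim x⟩
  obtain ⟨f, ε, hε, hf, hfrac, h⟩ := hw.exists_sub hr
  suffices hsum : IsPairingSum fun x y => w x y - ε * f.weight x y from
    hsum.add_smul hε f fun x y => by ring
  rcases h with ⟨x, hx⟩ | ⟨U, hU, hcut⟩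
  · refine ihm _ ?_ hfrac rfl
    rw [← hm]
    refine Finset.card_lt_card (Finset.ssubset_iff_of_subset ?_ |>.2 ⟨(x, f.1 x), ?_, ?_⟩)
    · rintro ⟨a, b⟩ hab
      simp only [Finset.mem_filter, Finset.mem_univ, true_and] at hab ⊢
      intro h0
      by_cases hfab : f.1 a = b
      · exact (hf a).ne' (hfab ▸ h0)
      · simp [Pairing.weight, hfab, h0] at hab
    · simpa using (hf x).ne'
    · simp [Pairing.weight, hx]
  · exact hfrac.isPairingSum_of_tight hU hcut (ih _)

/-! ### Greedy covering in bridgeless cubic graphs. -/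

section Cubic

variable {V : Type*} [Fintype V] [DecidableEq V]

/-- The polytope theorem yields a pairing of at least average value that meets every tight odd cut
exactly once. -/
lemma IsFractional.exists_pairing_ge [Nonempty V] {w : V → V → ℝ} (hw : IsFractional w 1)
    (c : V → V → ℝ) : ∃ f : Pairing V,
      ∑ x, ∑ y, c x y * w x y ≤ ∑ x, ∑ y, c x y * f.weight x y ∧ (∀ x, 0 < w x (f.1 x)) ∧
      ∀ U, Odd U.card → cut w U = 1 → f.crossing U = 1 := by
  obtain ⟨p, hp, hpw⟩ := hw.isPairingSum
  have hp1 : ∑ f, p f = 1 := by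
    rw [← hw.degree (Classical.arbitrary V)]
    simp_rw [← hpw]
    rw [Finset.sum_comm]
    simp_rw [← Finset.mul_sum, Pairing.sum_weight, mul_one]
  have hlin : ∑ f, p f * ∑ x, ∑ y, c x y * f.weight x y = ∑ x, ∑ y, c x y * w x y := by
    simp_rw [← hpw, Finset.mul_sum]
    rw [Finset.sum_comm]
    refine Finset.sum_congr rfl fun x _ => ?_
    rw [Finset.sum_comm]
    exact Finset.sum_congr rfl fun y _ => Finset.sum_congr rfl fun f _ => by ring
  -- Averaging only over pairings with positive coefficient ensures that the chosen one lies in the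
  -- support and on every tight face.
  have hfilter : ∀ q : Pairing V → ℝ, ∑ f with 0 < p f, p f * q f = ∑ f, p f * q f := fun q =>
    Finset.sum_filter_of_ne fun f _ h => (hp f).lt_of_ne (Ne.symm (left_ne_zero_of_mul h))
  obtain ⟨f, hf, hle⟩ := Finset.exists_le_of_sum_le (s := Finset.univ.filter (0 < p ·))
    (f := fun f => p f * ∑ x, ∑ y, c x y * w x y)
    (g := fun f => p f * ∑ x, ∑ y, c x y * f.weight x y) (by
      by_contra h
      have := hfilter fun _ => 1
      rw [Finset.not_nonempty_iff_eq_empty.1 h] at this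
      simp [hp1] at this) (by
      rw [hfilter, hfilter fun _ => _, ← Finset.sum_mul, hp1, one_mul, hlin])
  simp only [Finset.mem_filter, Finset.mem_univ, true_and] at hf
  refine ⟨f, le_of_mul_le_mul_left hle hf, fun x => ?_, fun U hU hcut => ?_⟩
  · rw [← hpw]
    refine Finset.sum_pos' (fun g _ => mul_nonneg (hp g) (g.weight_nonneg _ _))
      ⟨f, Finset.mem_univ _, ?_⟩
    simpa [Pairing.weight] using hf
  · have h1 : ∑ g, p g * cut g.weight U = 1 := by
      rw [← hcut]
      simp_rw [cut, ← hpw, Finset.mul_sum]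
      rw [Finset.sum_comm]
      exact Finset.sum_congr rfl fun x _ => Finset.sum_comm
    -- Each pairing crosses at least once and the average is 1, so those with positive coefficient
    -- cross exactly once.
    have h2 : ∑ g, p g * (cut g.weight U - 1) = 0 := by
      simp_rw [mul_sub, Finset.sum_sub_distrib, mul_one, hp1, h1, sub_self]
    have h3 := (Finset.sum_eq_zero_iff_of_nonneg fun g _ =>
      mul_nonneg (hp g) (sub_nonneg.2 (g.one_le_cut hU))).1 h2 f (Finset.mem_univ _)
    have h4 := sub_eq_zero.1 ((mul_eq_zero.1 h3).resolve_left hf.ne')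
    rw [f.cut_weight] at h4
    exact_mod_cast h4

variable (G : SimpleGraph V) [DecidableRel G.Adj]

/-- The number of edges of `G` leaving `U`. -/
def edgeCut (U : Finset V) : ℕ := ∑ x ∈ U, ∑ y ∈ Uᶜ, if G.Adj x y then 1 else 0

/-- The adjacency indicator as a weight. -/
def adjWeight (x y : V) : ℝ := if G.Adj x y then 1 else 0

omit [DecidableEq V] in
lemma sum_adjWeight (x : V) : ∑ y, adjWeight G x y = G.degree x := by
  simp [adjWeight, ← SimpleGraph.card_neighborFinset_eq_degree,
    SimpleGraph.neighborFinset_eq_filter]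

lemma cut_adjWeight (U : Finset V) : cut (adjWeight G) U = edgeCut G U := by
  simp only [cut, adjWeight, edgeCut, Nat.cast_sum, Nat.cast_ite, Nat.cast_one, Nat.cast_zero]

variable {G}

lemma odd_edgeCut (hG : G.IsRegularOfDegree 3) {U : Finset V} (hU : Odd U.card) :
    Odd (edgeCut G U) := by
  refine odd_natCut (fun x y => if G.Adj x y then 1 else 0) (fun x y => ?_) (fun x => ?_)
    (fun x => ?_) hU
  · simp only [G.adj_comm]
  · simp
  · have h : ∑ y, (if G.Adj x y then 1 else 0) = 3 := by
      rw [← hG.degree_eq x, ← SimpleGraph.card_neighborFinset_eq_degree,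
        SimpleGraph.neighborFinset_eq_filter, Finset.card_filter]
    rw [h]
    decide

/-- A walk joining the ends of the only cut edge must leave `U` through that edge. -/
lemma exists_isBridge_of_edgeCut_eq_one {U : Finset V} (h : edgeCut G U = 1) :
    ∃ e ∈ G.edgeSet, G.IsBridge e := by
  have hiff : ∃ p : V × V, ∀ x y, (x ∈ U ∧ y ∉ U ∧ G.Adj x y) ↔ (x, y) = p := by
    rw [edgeCut, ← Finset.sum_product', ← Finset.card_filter, Finset.card_eq_one] at h
    obtain ⟨p, hp⟩ := h
    refine ⟨p, fun x y => ?_⟩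
    rw [← Finset.mem_singleton, ← hp]
    simp [and_assoc]
  obtain ⟨⟨x, y⟩, hp⟩ := hiff
  obtain ⟨hx, hy, hxy⟩ := (hp x y).2 rfl
  refine ⟨s(x, y), hxy, ?_⟩
  rw [SimpleGraph.isBridge_iff]
  rintro ⟨q⟩
  obtain ⟨d, -, hd, hd'⟩ := q.exists_boundary_dart (U : Set V) (by simpa using hx) (by simpa using hy)
  have hadj := d.adj
  rw [SimpleGraph.deleteEdges_adj] at hadj
  have := (hp d.fst d.snd).1 ⟨by simpa using hd, by simpa using hd', hadj.1⟩
  rw [Prod.mk.injEq] at this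
  exact hadj.2 (by rw [this.1, this.2]; rfl)

lemma three_le_edgeCut (hG : G.IsRegularOfDegree 3) (hb : ∀ e ∈ G.edgeSet, ¬ G.IsBridge e)
    {U : Finset V} (hU : Odd U.card) : 3 ≤ edgeCut G U := by
  have h1 : edgeCut G U ≠ 1 := fun h => by
    obtain ⟨e, he, h⟩ := exists_isBridge_of_edgeCut_eq_one h
    exact hb e he h
  obtain ⟨m, hm⟩ := odd_edgeCut hG hU
  omega

variable (G) in
/-- Families of perfect matchings of `G` meeting odd cuts sparsely enough to be continued. -/
structure IsSparse {k : ℕ} (F : Fin k → Pairing V) : Prop where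
  adj : ∀ i x, G.Adj x ((F i).1 x)
  cut_le : ∀ U : Finset V, Odd U.card →
    2 * k + 3 + ∑ i, (F i).crossing U ≤ (k + 1) * edgeCut G U

variable (G) in
/-- The fractional perfect matching that favours edges rarely used by `F`. -/
noncomputable def residual {k : ℕ} (F : Fin k → Pairing V) (x y : V) : ℝ :=
  ((k + 1) * adjWeight G x y - ∑ i, (F i).weight x y) / (2 * k + 3)

omit [Fintype V] in
lemma weight_le_adjWeight {f : Pairing V} (hf : ∀ x, G.Adj x (f.1 x)) (x y : V) :
    f.weight x y ≤ adjWeight G x y := by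
  unfold Pairing.weight adjWeight
  by_cases h : f.1 x = y
  · simp [← h, hf]
  · rw [if_neg h]
    split_ifs <;> simp

lemma cut_residual {k : ℕ} (F : Fin k → Pairing V) (U : Finset V) :
    cut (residual G F) U =
      ((k + 1) * edgeCut G U - ∑ i, ((F i).crossing U : ℝ)) / (2 * k + 3) := by
  simp_rw [← cut_adjWeight, ← Pairing.cut_weight, cut, residual, ← Finset.sum_div,
    Finset.sum_sub_distrib, ← Finset.mul_sum]
  congr 2
  rw [Finset.sum_comm (s := Finset.univ)]
  exact Finset.sum_congr rfl fun x _ => Finset.sum_comm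

/-- `cut_le` is the odd cut condition multiplied by `2k + 3`, and the degree is `(3(k + 1) - k) /
(2k + 3) = 1`. -/
lemma IsSparse.isFractional (hG : G.IsRegularOfDegree 3) {k : ℕ} {F : Fin k → Pairing V}
    (hF : IsSparse G F) : IsFractional (residual G F) 1 := by
  have hpos : (0 : ℝ) < 2 * k + 3 := by positivity
  refine ⟨fun x y => ?_, fun x => ?_, fun x y => ?_, fun x => ?_, fun U hU => ?_⟩
  · simp only [residual, adjWeight, G.adj_comm x y, Pairing.weight_symm _ x y]
  · simp [residual, adjWeight, Pairing.weight_self]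
  · refine div_nonneg (sub_nonneg.2 ?_) hpos.le
    calc ∑ i, (F i).weight x y ≤ ∑ _i : Fin k, adjWeight G x y :=
          Finset.sum_le_sum fun i _ => weight_le_adjWeight (hF.adj i) x y
      _ = k * adjWeight G x y := by simp
      _ ≤ (k + 1) * adjWeight G x y := by
          refine mul_le_mul_of_nonneg_right (by linarith) ?_
          unfold adjWeight
          split_ifs <;> simp
  · simp only [residual]
    rw [← Finset.sum_div, Finset.sum_sub_distrib, ← Finset.mul_sum, sum_adjWeight, hG.degree_eq,
      Finset.sum_comm]
    simp_rw [Pairing.sum_weight]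
    simp
    field_simp
    ring
  · rw [cut_residual, le_div_iff₀ hpos]
    have : ((2 * k + 3 + ∑ i, (F i).crossing U : ℕ) : ℝ) ≤ ((k + 1) * edgeCut G U : ℕ) := by
      exact_mod_cast hF.cut_le U hU
    push_cast at this
    linarith

lemma crossing_le_edgeCut {f : Pairing V} (hf : ∀ x, G.Adj x (f.1 x)) (U : Finset V) :
    f.crossing U ≤ edgeCut G U := by
  refine Finset.sum_le_sum fun x _ => Finset.sum_le_sum fun y _ => ?_
  by_cases h : f.1 x = y
  · simp [← h, hf]
  · simp [h]

/-- Passing to `k + 1` raises the left side of `cut_le` by `2 + f.crossing U` and the right side by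
`edgeCut G U`. On a tight cut `f` crosses once, and `3 ≤ edgeCut G U` suffices; elsewhere a slack of
2 suffices, since `f.crossing U ≤ edgeCut G U`. -/
lemma IsSparse.exists_snoc [Nonempty V] (hG : G.IsRegularOfDegree 3)
    (hb : ∀ e ∈ G.edgeSet, ¬ G.IsBridge e) {k : ℕ} {F : Fin k → Pairing V}
    (hF : IsSparse G F) (c : V → V → ℝ) : ∃ f : Pairing V,
      IsSparse G (Fin.snoc F f : Fin (k + 1) → Pairing V) ∧
      ∑ x, ∑ y, c x y * residual G F x y ≤ ∑ x, ∑ y, c x y * f.weight x y := by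
  have hpos : (0 : ℝ) < 2 * k + 3 := by positivity
  obtain ⟨f, hc, hsupp, htight⟩ := (hF.isFractional hG).exists_pairing_ge c
  have hadj : ∀ x, G.Adj x (f.1 x) := by
    intro x
    by_contra h
    refine (hsupp x).not_ge (div_nonpos_of_nonpos_of_nonneg ?_ hpos.le)
    simp only [adjWeight, h, if_false, mul_zero, zero_sub, neg_nonpos]
    exact Finset.sum_nonneg fun i _ => (F i).weight_nonneg _ _
  refine ⟨f, ⟨fun i x => ?_, fun U hU => ?_⟩, hc⟩
  · refine Fin.lastCases ?_ (fun i => ?_) i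
    · simpa using hadj x
    · simpa using hF.adj i x
  · rw [Fin.sum_univ_castSucc]
    simp only [Fin.snoc_castSucc, Fin.snoc_last]
    have h3 := three_le_edgeCut hG hb hU
    have hle := hF.cut_le U hU
    have hfle := crossing_le_edgeCut hadj U
    have hexp : (k + 1 + 1) * edgeCut G U = (k + 1) * edgeCut G U + edgeCut G U := by ring
    rcases hle.eq_or_lt with heq | hlt
    · have h1 := htight U hU (by
        rw [cut_residual, div_eq_one_iff_eq hpos.ne']
        have : ((2 * k + 3 + ∑ i, (F i).crossing U : ℕ) : ℝ) = ((k + 1) * edgeCut G U : ℕ) := by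
          exact_mod_cast heq
        push_cast at this
        linarith)
      omega
    -- Both sides of `cut_le` have the parity of `k + 1`, so a strict inequality has slack at least
    -- 2.
    · have hS : Odd (∑ i, (F i).crossing U) ↔ Odd k := by
        rw [Finset.odd_sum_iff_odd_card_odd,
          Finset.filter_true_of_mem fun i _ => (F i).odd_crossing hU]
        simp
      have hm : Odd ((k + 1) * edgeCut G U) ↔ Odd (k + 1) := by
        rw [Nat.odd_mul]
        exact and_iff_left (odd_edgeCut hG hU)
      rw [Nat.odd_iff, Nat.odd_iff] at hS hm
      omega

variable (G) in
/-- The indicator of the edges not covered by `F`. -/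
def uncovered {k : ℕ} (F : Fin k → Pairing V) (x y : V) : ℝ :=
  if G.Adj x y ∧ ∀ i, (F i).1 x ≠ y then 1 else 0

omit [Fintype V] in
lemma uncovered_mul_residual {k : ℕ} (F : Fin k → Pairing V) (x y : V) :
    uncovered G F x y * residual G F x y = (k + 1) / (2 * k + 3) * uncovered G F x y := by
  unfold uncovered
  split_ifs with h
  · simp [residual, adjWeight, Pairing.weight, h.1, h.2]
  · simp

omit [Fintype V] in
lemma uncovered_snoc {k : ℕ} (F : Fin k → Pairing V) (f : Pairing V) (x y : V) :
    uncovered G (Fin.snoc F f : Fin (k + 1) → Pairing V) x y =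
      uncovered G F x y - uncovered G F x y * f.weight x y := by
  unfold uncovered Pairing.weight
  simp only [Fin.forall_fin_succ', Fin.snoc_castSucc, Fin.snoc_last]
  by_cases h : G.Adj x y ∧ ∀ i, (F i).1 x ≠ y <;> by_cases h' : f.1 x = y <;>
    simp [h, h']

lemma exists_family [Nonempty V] (hG : G.IsRegularOfDegree 3)
    (hb : ∀ e ∈ G.edgeSet, ¬ G.IsBridge e) (k : ℕ) : ∃ F : Fin k → Pairing V, IsSparse G F ∧
      ∑ x, ∑ y, uncovered G F x y ≤
        (∏ i ∈ Finset.range k, ((i : ℝ) + 2) / (2 * i + 3)) * ∑ x, ∑ y, adjWeight G x y := by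
  induction k with
  | zero =>
    refine ⟨Fin.elim0, ⟨fun i => i.elim0, fun U hU => ?_⟩, ?_⟩
    · simpa using three_le_edgeCut hG hb hU
    · simp [uncovered, adjWeight]
  | succ k ih =>
    obtain ⟨F, hF, hbound⟩ := ih
    -- With the uncovered indicator as objective, the value of `f` is the number of newly covered
    -- edges, counted as ordered pairs.
    obtain ⟨f, hf, hc⟩ := hF.exists_snoc hG hb (uncovered G F)
    refine ⟨_, hf, ?_⟩
    simp_rw [uncovered_snoc, Finset.sum_sub_distrib]
    simp_rw [uncovered_mul_residual, ← Finset.mul_sum] at hc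
    rw [Finset.prod_range_succ]
    have hpos : (0 : ℝ) < 2 * k + 3 := by positivity
    calc _ ≤ ((k : ℝ) + 2) / (2 * k + 3) * ∑ x, ∑ y, uncovered G F x y := by
          have : ((k : ℝ) + 2) / (2 * k + 3) = 1 - (k + 1) / (2 * k + 3) := by
            field_simp
            ring
          rw [this, sub_mul, one_mul]
          linarith
      _ ≤ ((k : ℝ) + 2) / (2 * k + 3) * _ := mul_le_mul_of_nonneg_left hbound (by positivity)
      _ = _ := by ring

omit [DecidableEq V] in
lemma sum_adjWeight_eq (H : SimpleGraph V) [DecidableRel H.Adj] :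
    ∑ x, ∑ y, adjWeight H x y = 2 * H.edgeSet.ncard := by
  simp_rw [sum_adjWeight]
  rw [Set.ncard_eq_toFinset_card', Set.toFinset_card]
  have := H.sum_degrees_eq_twice_card_edges
  rw [SimpleGraph.edgeFinset, Set.toFinset_card] at this
  exact_mod_cast this

omit [Fintype V] [DecidableEq V] [DecidableRel G.Adj] in
/-- A pairing along edges of `G`, as a subgraph. -/
def Pairing.toSubgraph (f : Pairing V) (hf : ∀ x, G.Adj x (f.1 x)) : G.Subgraph where
  verts := Set.univ
  Adj x y := f.1 x = y
  adj_sub := by rintro x _ rfl; exact hf x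
  edge_vert _ := Set.mem_univ _
  symm := ⟨fun _ _ h => f.apply_eq_comm.1 h⟩

end Cubic

end PairingPolytope

/-! ### From five pairings to five perfect matchings. -/

open PairingPolytope in
theorem corollary3p1 {V : Type*} [Fintype V] (G : SimpleGraph V) [DecidableRel G.Adj]
    (hcubic : G.IsRegularOfDegree 3)
    (hbridgeless : ∀ e ∈ G.edgeSet, ¬ G.IsBridge e) :
    ∃ M : Fin 5 → G.Subgraph,
      (∀ i, (M i).IsPerfectMatching) ∧
        ⌈(215 / 231 : ℚ) * (G.edgeSet.ncard : ℚ)⌉₊ ≤ (⋃ i, (M i).edgeSet).ncard := by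
  classical
  rcases isEmpty_or_nonempty V with hV | hV
  · refine ⟨fun _ => ⊤, fun _ => SimpleGraph.Subgraph.isPerfectMatching_iff.2 hV.elim, ?_⟩
    have : G.edgeSet = ∅ := Set.eq_empty_of_forall_notMem fun e => by
      induction e with
      | _ x _ => exact hV.elim x
    simp [this]
  obtain ⟨F, hF, hbound⟩ := exists_family hcubic hbridgeless 5
  let M : Fin 5 → G.Subgraph := fun i => (F i).toSubgraph (hF.adj i)
  refine ⟨M, fun i => SimpleGraph.Subgraph.isPerfectMatching_iff.2 fun v =>
    ⟨(F i).1 v, rfl, fun _ h => Eq.symm h⟩, ?_⟩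
  -- The union of the matchings as a graph, so that covered edges are counted by the same degree sum
  -- as those of `G`.
  let H : SimpleGraph V :=
    { Adj := fun x y => ∃ i, (F i).1 x = y
      symm := ⟨fun x y ⟨i, h⟩ => ⟨i, (F i).apply_eq_comm.1 h⟩⟩
      loopless := ⟨fun x ⟨i, h⟩ => ((F i).2 x).2 h⟩ }
  have hH : ⋃ i, (M i).edgeSet = H.edgeSet := by
    ext e
    induction e with
    | _ x y => simp only [Set.mem_iUnion, SimpleGraph.Subgraph.mem_edgeSet,
        SimpleGraph.mem_edgeSet]; rfl
  have hunc : ∀ x y, uncovered G F x y = adjWeight G x y - adjWeight H x y := by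
    intro x y
    unfold uncovered adjWeight
    by_cases h : H.Adj x y
    · obtain ⟨i, hi⟩ := id h
      have hadj : G.Adj x y := hi ▸ hF.adj i x
      rw [if_neg fun h' => h'.2 i hi, if_pos hadj, if_pos h, sub_self]
    · have h' : ∀ i, (F i).1 x ≠ y := fun i hi => h ⟨i, hi⟩
      simp only [h', h, ne_eq, not_false_eq_true, implies_true, and_true, if_false, sub_zero]
  simp_rw [hunc, Finset.sum_sub_distrib, sum_adjWeight_eq] at hbound
  -- The product evaluates to `16/231`, and `1 - 16/231 = 215/231`.
  norm_num [Finset.prod_range_succ] at hbound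
  have hnat : 215 * G.edgeSet.ncard ≤ 231 * H.edgeSet.ncard := by
    have : (215 : ℝ) * G.edgeSet.ncard ≤ 231 * H.edgeSet.ncard := by linarith
    exact_mod_cast this
  rw [hH, Nat.ceil_le]
  have : (215 : ℚ) * G.edgeSet.ncard ≤ 231 * H.edgeSet.ncard := by exact_mod_cast hnat
  linarith
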